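/- Let \(p\) be an odd prime. A partition is called \(p\)-core if none of its hook lengths is divisible by \(p\), and a \(p'\)-partition if none of its parts is divisible by \(p\). To a partition \(\lambda_1 \ge \dots \ge \lambda_\ell \ge 1\) associate its \(p\)-abacus: the positions \(0, 1, 2, \dots\) are arranged in rows of length \(p\), the rows being \(\{jp, jp+1, \dots, jp+p-1\}\) for \(j \ge 0\), there are beads in the \(\ell\) positions \(\lambda_k + \ell - k\) \((1 \le k \le \ell)\), and all other positions are gaps (so position \(0\) is a gap, and the bead of \(\lambda_k\) is preceded by exactly \(\lambda_k\) gaps). The beads are rightmost within their rows if in each row every gap precedes every bead. For \(1 \le i \le p-1\), the \(i\)th row multiplicity \(m_i\) is the number of rows containing exactly \(i\) gaps and \(p-i\) beads. Then among all \(p\)-core \(p'\)-partitions (of all sizes) there is one of largest size, and it is unique. The beads on its \(p\)-abacus are rightmost within their rows, and its row multiplicities satisfy \(m_i = m_{p-i}\) for \(2 \le i \le p-2\), and \(m_1 = m_{p-1} + 1\). -/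

import Mathlib

namespace YoungDiagram

/-- The hook length of the cell in row `i` and column `j` (both counted from `0`):
arm length plus leg length plus one. It is used only for cells of the diagram. -/
def hookLength (μ : YoungDiagram) (i j : ℕ) : ℕ :=
  (μ.rowLen i - (j + 1)) + (μ.colLen j - (i + 1)) + 1

/-- A partition is `p`-core if none of its hook lengths is divisible by `p`. -/
def IsPCore (p : ℕ) (μ : YoungDiagram) : Prop :=
  ∀ i j : ℕ, (i, j) ∈ μ → ¬ p ∣ μ.hookLength i j

/-- A partition is a `p'`-partition if none of its parts is divisible by `p`. -/
def IsPPrime (p : ℕ) (μ : YoungDiagram) : Prop :=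
  ∀ x ∈ μ.rowLens, ¬ p ∣ x

/-- `μ` is a `p`-core `p'`-partition of the largest possible size. -/
def IsLargestPCorePPrime (p : ℕ) (μ : YoungDiagram) : Prop :=
  μ.IsPCore p ∧ μ.IsPPrime p ∧
    ∀ ν : YoungDiagram, ν.IsPCore p → ν.IsPPrime p → ν.card ≤ μ.card

/-- The positions of the beads on the abacus of `μ` with a gap in position `0`. There is one
bead for each part; with `ℓ = μ.colLen 0` parts, indexed by `k = 0, …, ℓ - 1` in weakly
decreasing order, the bead of the `k`-th part has exactly `ℓ - 1 - k` beads and `μ.rowLen k`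
gaps before it. -/
def beads (μ : YoungDiagram) : Finset ℕ :=
  (Finset.range (μ.colLen 0)).image fun k => μ.rowLen k + (μ.colLen 0 - 1 - k)

/-- The positions `j * p, …, j * p + p - 1` in the `j`-th row (counted from `0`) of the
`p`-abacus; position `j * p + r` is on runner `r`. -/
def abacusRow (p j : ℕ) : Finset ℕ :=
  Finset.Ico (j * p) (j * p + p)

/-- The number of beads in the `j`-th row of the `p`-abacus of `μ`. -/
def rowBeads (p : ℕ) (μ : YoungDiagram) (j : ℕ) : ℕ :=
  ((abacusRow p j).filter (· ∈ μ.beads)).card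

/-- The number of gaps in the `j`-th row of the `p`-abacus of `μ`. -/
def rowGaps (p : ℕ) (μ : YoungDiagram) (j : ℕ) : ℕ :=
  ((abacusRow p j).filter (· ∉ μ.beads)).card

/-- All beads on the `p`-abacus of `μ` are rightmost within their rows. -/
def BeadsRightmost (p : ℕ) (μ : YoungDiagram) : Prop :=
  ∀ j : ℕ, ∀ x ∈ abacusRow p j, ∀ y ∈ abacusRow p j, x ≤ y → x ∈ μ.beads → y ∈ μ.beads

/-- The `i`-th row multiplicity: the number of rows of the `p`-abacus of `μ` containing exactly
`i` gaps and `p - i` beads (for `1 ≤ i ≤ p - 1`). -/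
noncomputable def rowMultiplicity (p : ℕ) (μ : YoungDiagram) (i : ℕ) : ℕ :=
  {j : ℕ | μ.rowGaps p j = i ∧ μ.rowBeads p j = p - i}.ncard

end YoungDiagram

/-!
The size of a partition is the number of pairs of a bead and an earlier gap on its abacus, the part
of a bead is the number of gaps before it, and the partition is a `p`-core exactly if the beads are
flush on each runner (`YoungDiagram.isPCore_iff`).

*Reduction to increasing runners.* Shift the abacus of a `p`-core `p'`-partition so that its last
bead is on the last runner. Then every row with a bead has a bead at its right end, so the number
of gaps in the rows `0, …, j` is not divisible by `p` as long as row `j` has a bead. This condition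
depends only on the bead counts of the runners, not on their order. Two runners whose counts differ
by `D` contribute `D (D + 1) / 2` pairs to the size if the fuller one is on the right, and `D` fewer
otherwise. So sorting the runners does not decrease the size, and it preserves the size only if the
abacus was sorted and not shifted (`YoungDiagram.exists_isRunnerProfile`). It remains to maximize
`spread p c` over the sorted count sequences `c` with this condition (`IsRunnerProfile`).

*The walk.* With `m_g = c g - c (g - 1)` rows that have `g` gaps, the numbers of gaps above the rows
form a walk modulo `p` that starts at `0`, takes `m_1` steps `1`, then `m_2` steps `2`, and so on,
and never returns to `0`. So `m_g = p - a_g - b_{g - 1}` with `a_g > 0`, `b_g ≥ 0`, `b_0 = 0` and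
`p ∣ k a_k + (k + 1) b_k` for `1 ≤ k ≤ p - 2`; conversely, such numbers describe such a walk
(`IsRunnerProfile.exists_walk`, `isRunnerProfile_of_walk`).

*Optimization.* For each `k`, one pair `(a_k, b_k)` minimizes `k a + (k + 1) b` and
`(p - k) a + (p - k - 1) b` simultaneously (`exists_isBestPair`). Choosing all these pairs, together
with `a_{p - 1} = 1`, maximizes every cut sum `∑_{i < g ≤ k} (c k - c i)` (`cutSum_nonneg`). Up to a
constant, the spread is a quadratic form in the numbers `m_g + 1 / p > 0`, with gradient
proportional to the cut sums; therefore the choice also maximizes the spread, and it is the only one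
that does (`spread_le_spread`). The best pair for `p - 1 - k` is the best pair for `k` with its
entries exchanged (`IsBestPair.swap`), whence `m_g = m_{p - g}` for `2 ≤ g ≤ p - 2`; at the
boundary, `b_0 = 0` and `a_{p - 1} = 1` give `m_1 = m_{p - 1} + 1`.
-/

/-! ### Best pairs -/

/-- For `p = k + l + 1`, a pair of positive integers `(a, b)` with `p ∣ k a + (k + 1) b` that
minimizes both `k a + (k + 1) b` and `(l + 1) a + l b` among all nonzero pairs of natural numbers
subject to this divisibility. -/
structure IsBestPair (k l a b : ℕ) : Prop where
  left_pos : 0 < a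
  right_pos : 0 < b
  dvd : k + l + 1 ∣ k * a + (k + 1) * b
  le_left : ∀ a' b', 0 < a' + b' → k + l + 1 ∣ k * a' + (k + 1) * b' →
    k * a + (k + 1) * b ≤ k * a' + (k + 1) * b'
  le_right : ∀ a' b', 0 < a' + b' → k + l + 1 ∣ k * a' + (k + 1) * b' →
    (l + 1) * a + l * b ≤ (l + 1) * a' + l * b'

/-- The two functionals add up to `(k + l + 1) (a + b)`, so they are divisible together. -/
lemma dvd_swap {k l a b : ℕ} (h : k + l + 1 ∣ k * a + (k + 1) * b) :
    l + k + 1 ∣ l * b + (l + 1) * a := by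
  have h2 : k + l + 1 ∣ (k * a + (k + 1) * b) + (l * b + (l + 1) * a) := ⟨a + b, by ring⟩
  rw [add_comm l k]
  exact (Nat.dvd_add_right h).1 h2

lemma IsBestPair.swap {k l a b : ℕ} (h : IsBestPair k l a b) : IsBestPair l k b a where
  left_pos := h.right_pos
  right_pos := h.left_pos
  dvd := dvd_swap h.dvd
  le_left a' b' h0 hd := by
    have := h.le_right b' a' (by omega) (dvd_swap hd)
    linarith
  le_right a' b' h0 hd := by
    have := h.le_left b' a' (by omega) (dvd_swap hd)
    linarith

lemma IsBestPair.unique {k l a b a' b' : ℕ} (h : IsBestPair k l a b)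
    (h' : IsBestPair k l a' b') : a = a' ∧ b = b' := by
  have h1 := le_antisymm (h.le_left a' b' (by have := h'.left_pos; omega) h'.dvd)
    (h'.le_left a b (by have := h.left_pos; omega) h.dvd)
  have h2 := le_antisymm (h.le_right a' b' (by have := h'.left_pos; omega) h'.dvd)
    (h'.le_right a b (by have := h.left_pos; omega) h.dvd)
  zify at *
  have hp : ((k : ℤ) + l + 1) ≠ 0 := by positivity
  constructor
  · apply mul_left_cancel₀ hp
    linear_combination (k + 1) * h2 - l * h1
  · apply mul_left_cancel₀ hp
    linear_combination (l + 1) * h1 - k * h2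

/-- A positive pair subject to the divisibility whose sum is about half of `p = k + l + 1`: it
bounds the sum of the best pair. -/
lemma exists_pair_add_le {k l : ℕ} (hk : 0 < k) (hl : 0 < l) (hodd : Odd (k + l + 1)) :
    ∃ a b : ℕ, 0 < a ∧ 0 < b ∧ k + l + 1 ∣ k * a + (k + 1) * b ∧
      2 * (a + b) ≤ k + l + 2 ∧ (Even k → 2 * (a + b) ≤ k + l) := by
  rcases Nat.even_or_odd' k with ⟨u, rfl | rfl⟩
  · obtain ⟨v, rfl⟩ : ∃ v, l = 2 * v := by
      obtain ⟨w, hw⟩ := hodd; exact ⟨w - u, by omega⟩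
    exact ⟨v, u, by omega, by omega, ⟨u, by ring⟩, by omega, fun _ => by omega⟩
  · obtain ⟨v, rfl⟩ : ∃ v, l = 2 * v + 1 := by
      obtain ⟨w, hw⟩ := hodd; exact ⟨w - u - 1, by omega⟩
    refine ⟨u + 1, v + 1, by omega, by omega, ⟨u + 1, by ring⟩, by omega, fun h => ?_⟩
    exact absurd h (by simp)

/-- The pair with the smallest sum is best. The quotients `κ = (k a + (k + 1) b) / p` and
`ν = ((l + 1) a + l b) / p` satisfy `k / p < κ / (κ + ν) < (k + 1) / p`, an interval of length
`1 / p`; so with `κ + ν = a + b ≤ p` minimal, neither `κ` nor `ν` can be lowered. -/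
lemma exists_isBestPair {k l : ℕ} (hk : 0 < k) (hl : 0 < l) (hp : (k + l + 1).Prime)
    (hodd : Odd (k + l + 1)) :
    ∃ a b : ℕ, IsBestPair k l a b ∧
      2 * (a + b) ≤ k + l + 2 ∧ (Even k → 2 * (a + b) ≤ k + l) := by
  classical
  let P : ℕ → Prop := fun w => ∃ a b : ℕ, a + b = w ∧ 0 < a ∧ 0 < b ∧
    k + l + 1 ∣ k * a + (k + 1) * b
  obtain ⟨a₀, b₀, ha₀, hb₀, hd₀, hs, hs'⟩ := exists_pair_add_le hk hl hodd
  have hex : ∃ w, P w := ⟨_, a₀, b₀, rfl, ha₀, hb₀, hd₀⟩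
  obtain ⟨a, b, hab, ha, hb, hd⟩ := Nat.find_spec hex
  have hle₀ : a + b ≤ a₀ + b₀ := hab ▸ Nat.find_min' hex ⟨a₀, b₀, rfl, ha₀, hb₀, hd₀⟩
  have hmin : ∀ a' b', 0 < a' + b' → k + l + 1 ∣ k * a' + (k + 1) * b' → a + b ≤ a' + b' := by
    intro a' b' h0 hd'
    rcases Nat.eq_zero_or_pos a' with rfl | ha'
    · have : k + l + 1 ∣ b' := by
        rw [mul_zero, zero_add] at hd'
        exact (hp.dvd_mul.1 hd').resolve_left (Nat.not_dvd_of_pos_of_lt (by omega) (by omega))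
      have := Nat.le_of_dvd (by omega) this
      omega
    rcases Nat.eq_zero_or_pos b' with rfl | hb'
    · have : k + l + 1 ∣ a' := by
        rw [mul_zero, add_zero] at hd'
        exact (hp.dvd_mul.1 hd').resolve_left (Nat.not_dvd_of_pos_of_lt (by omega) (by omega))
      have := Nat.le_of_dvd (by omega) this
      omega
    exact hab ▸ Nat.find_min' hex ⟨a', b', rfl, ha', hb', hd'⟩
  have key : ∀ {r s x y x' y' : ℕ}, 0 < x → x + y < r + s + 1 → x + y ≤ x' + y' →
      r + s + 1 ∣ r * x + (r + 1) * y → r + s + 1 ∣ r * x' + (r + 1) * y' →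
      r * x + (r + 1) * y ≤ r * x' + (r + 1) * y' := by
    rintro r s x y x' y' hx hlt hle ⟨t, ht⟩ ⟨t', ht'⟩
    rw [ht, ht']
    refine Nat.mul_le_mul_left _ ?_
    by_contra hcon
    have h1 : (r + s + 1) * (t' + 1) ≤ (r + s + 1) * t := Nat.mul_le_mul_left _ (by omega)
    have h2 : r * (x + y) ≤ r * (x' + y') := Nat.mul_le_mul_left _ hle
    nlinarith
  refine ⟨a, b, ⟨ha, hb, hd, fun a' b' h0 hd' => ?_, fun a' b' h0 hd' => ?_⟩, by omega,
    fun h => by have := hs' h; omega⟩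
  · exact key ha (by omega) (hmin a' b' h0 hd') hd hd'
  · have := key (r := l) (s := k) hb (by omega) (x' := b') (y' := a')
      (by have := hmin a' b' h0 hd'; omega) (dvd_swap hd) (dvd_swap hd')
    linarith

/-! ### Runner profiles -/

/-- The weakly increasing sequences `0 = c 0 ≤ c 1 ≤ … ≤ c (p - 1)` such that, on the `p`-abacus
with beads in the first `c i` rows of runner `i`, the number of gaps in the rows `0, …, j` is not
divisible by `p` as long as row `j` has a bead. Only the values of `c` on `0, …, p - 1` matter. -/
structure IsRunnerProfile (p : ℕ) (c : ℕ → ℕ) : Prop where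
  zero : c 0 = 0
  le_succ : ∀ i, i + 1 < p → c i ≤ c (i + 1)
  not_dvd : ∀ j, j < c (p - 1) → ¬ p ∣ ∑ i ∈ Finset.range p, (j + 1 - c i)

lemma le_of_le_succ {p : ℕ} {c : ℕ → ℕ} (h : ∀ i, i + 1 < p → c i ≤ c (i + 1)) {i k : ℕ}
    (hik : i ≤ k) (hk : k < p) : c i ≤ c k := by
  induction k, hik using Nat.le_induction with
  | base => exact le_rfl
  | succ n hn ih => exact (ih (by omega)).trans (h n hk)

/-- The number of gaps in the rows above row `c g`. -/
def gapsAbove (c : ℕ → ℕ) (g : ℕ) : ℕ := ∑ i ∈ Finset.range g, (c g - c i)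

/-- The rows `c g, …, c (g + 1) - 1` have `g + 1` gaps each. -/
lemma sum_gaps_eq {p : ℕ} {c : ℕ → ℕ} (h : ∀ i, i + 1 < p → c i ≤ c (i + 1)) {g s : ℕ}
    (hg : g + 1 < p) (hs : c g + s ≤ c (g + 1)) :
    ∑ i ∈ Finset.range p, (c g + s - c i) = gapsAbove c g + (g + 1) * s := by
  have hsub : Finset.range (g + 1) ⊆ Finset.range p :=
    Finset.range_subset_range.2 (by omega)
  rw [← Finset.sum_subset hsub (fun i hi hi' => ?_), Finset.sum_range_succ, gapsAbove]
  · have : ∑ i ∈ Finset.range g, (c g + s - c i) = ∑ i ∈ Finset.range g, ((c g - c i) + s) := by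
      refine Finset.sum_congr rfl fun i hi => ?_
      have := le_of_le_succ h (Finset.mem_range.1 hi).le (by omega)
      omega
    rw [this, Finset.sum_add_distrib, Finset.sum_const, Finset.card_range, smul_eq_mul,
      Nat.add_sub_cancel_left]
    ring
  · rw [Finset.mem_range] at hi hi'
    have := le_of_le_succ h (show g + 1 ≤ i by omega) hi
    omega

lemma gapsAbove_succ {p : ℕ} {c : ℕ → ℕ} (h : ∀ i, i + 1 < p → c i ≤ c (i + 1)) {g : ℕ}
    (hg : g + 1 < p) : gapsAbove c (g + 1) = gapsAbove c g + (g + 1) * (c (g + 1) - c g) := by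
  have h1 := h g hg
  rw [← sum_gaps_eq h hg (show c g + (c (g + 1) - c g) ≤ c (g + 1) by omega),
    show c g + (c (g + 1) - c g) = c (g + 1) by omega]
  have hsub : Finset.range (g + 1) ⊆ Finset.range p :=
    Finset.range_subset_range.2 (by omega)
  rw [← Finset.sum_subset hsub (fun i hi hi' => ?_), gapsAbove]
  rw [Finset.mem_range] at hi hi'
  have := le_of_le_succ h (show g + 1 ≤ i by omega) hi
  omega

/-- The walk of partial gap counts modulo `p`, read in units of the current step. In the rows with
`g + 1` gaps it moves from `(g + 1) b_g` to `- (g + 1) a_{g + 1}` in steps of `g + 1`; not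
meeting `0` forces the number of these rows to be `p - a_{g + 1} - b_g`. -/
lemma IsRunnerProfile.exists_walk {p : ℕ} (hp : p.Prime) {c : ℕ → ℕ} (hc : IsRunnerProfile p c) :
    ∃ a b : ℕ → ℕ, b 0 = 0 ∧
      (∀ g, g + 1 < p → 0 < a (g + 1) ∧ c (g + 1) + a (g + 1) + b g = c g + p) ∧
      ∀ k, 0 < k → k + 1 < p → p ∣ k * a k + (k + 1) * b k := by
  have : Fact p.Prime := ⟨hp⟩
  let b : ℕ → ℕ := fun g => ((gapsAbove c g : ZMod p) / ((g + 1 : ℕ) : ZMod p)).val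
  have hb : ∀ g, b g < p := fun g => ZMod.val_lt _
  have hb' : ∀ g, g + 1 < p → (((g + 1) * b g : ℕ) : ZMod p) = gapsAbove c g := by
    intro g hg
    have h0 : ((g + 1 : ℕ) : ZMod p) ≠ 0 := by
      rw [Ne, ZMod.natCast_eq_zero_iff]
      exact Nat.not_dvd_of_pos_of_lt (by omega) hg
    rw [Nat.cast_mul, ZMod.natCast_val, ZMod.cast_id', id, mul_div_cancel₀ _ h0]
  have hlt : ∀ g, g + 1 < p → c (g + 1) + b g < c g + p := by
    intro g hg
    by_contra! hcon
    have h1 := hb g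
    have h2 : c (g + 1) ≤ c (p - 1) := le_of_le_succ hc.le_succ (by omega) (by omega)
    refine hc.not_dvd (c g + (p - b g) - 1) (by omega) ?_
    rw [show c g + (p - b g) - 1 + 1 = c g + (p - b g) by omega,
      sum_gaps_eq hc.le_succ hg (by omega), ← ZMod.natCast_eq_zero_iff, Nat.cast_add, ← hb' g hg,
      ← Nat.cast_add, ← mul_add, show b g + (p - b g) = p by omega]
    simp
  refine ⟨fun g => c (g - 1) + p - c g - b (g - 1), b, by simp [b, gapsAbove], ?_, ?_⟩
  · intro g hg
    have := hlt g hg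
    simp only [Nat.add_sub_cancel]
    omega
  · intro k hk hkp
    obtain ⟨g, rfl⟩ : ∃ g, k = g + 1 := ⟨k - 1, by omega⟩
    have h1 := hlt g (by omega)
    have h2 := hc.le_succ g (by omega)
    have h3 := hb' g (by omega)
    rw [← ZMod.natCast_eq_zero_iff, Nat.cast_add, hb' _ hkp,
      gapsAbove_succ hc.le_succ (by omega), Nat.cast_add, ← h3, ← Nat.cast_add, ← Nat.cast_add,
      ← mul_add, ← mul_add]
    simp only [Nat.add_sub_cancel]
    rw [show c g + p - c (g + 1) - b g + (b g + (c (g + 1) - c g)) = p by omega]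
    simp

/-- Conversely, a sequence of this shape is a runner profile. -/
lemma isRunnerProfile_of_walk {p : ℕ} (hp : p.Prime) {c a b : ℕ → ℕ} (hc0 : c 0 = 0)
    (hb0 : b 0 = 0) (hle : ∀ i, i + 1 < p → c i ≤ c (i + 1))
    (hab : ∀ g, g + 1 < p → 0 < a (g + 1) ∧ c (g + 1) + a (g + 1) + b g = c g + p)
    (hd : ∀ k, 0 < k → k + 1 < p → p ∣ k * a k + (k + 1) * b k) : IsRunnerProfile p c := by
  have : Fact p.Prime := ⟨hp⟩
  have hX : ∀ g, g + 1 < p → (((g + 1) * b g : ℕ) : ZMod p) = gapsAbove c g := by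
    intro g
    induction g with
    | zero => intro _; simp [hb0, gapsAbove]
    | succ g ih =>
      intro hg
      have h1 := hab g (by omega)
      have h2 := hle g (by omega)
      have h3 := (ZMod.natCast_eq_zero_iff _ _).2 (hd (g + 1) (by omega) hg)
      rw [gapsAbove_succ hle (by omega), Nat.cast_add, ← ih (by omega)]
      have h4 : (((g + 1) * a (g + 1) + ((g + 1) * b g + (g + 1) * (c (g + 1) - c g)) : ℕ) :
          ZMod p) = 0 := by
        rw [← mul_add, ← mul_add,
          show a (g + 1) + (b g + (c (g + 1) - c g)) = p by omega]
        simp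
      rw [Nat.cast_add] at h3 h4
      rw [← Nat.cast_add]
      exact add_left_cancel (h3.trans h4.symm)
  refine ⟨hc0, hle, fun j hj => ?_⟩
  -- the group of rows that contains row `j`
  obtain ⟨g, hg, hgj, hjg⟩ : ∃ g, g + 1 < p ∧ c g ≤ j ∧ j < c (g + 1) := by
    have hex : ∃ g, j < c g := ⟨_, hj⟩
    have h1 := Nat.find_spec hex
    have h2 := Nat.find_min' hex hj
    have h3 : Nat.find hex ≠ 0 := fun h => by rw [h, hc0] at h1; omega
    refine ⟨Nat.find hex - 1, ?_, ?_, ?_⟩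
    · have := hp.two_le; omega
    · exact not_lt.1 (Nat.find_min hex (by omega))
    · rwa [Nat.sub_add_cancel (by omega)]
  have h1 := hab g hg
  obtain ⟨s, rfl⟩ : ∃ s, j = c g + s := ⟨j - c g, by omega⟩
  rw [add_assoc, sum_gaps_eq hle hg (by omega), ← ZMod.natCast_eq_zero_iff, Nat.cast_add,
    ← hX g hg, ← Nat.cast_add, ← mul_add, ZMod.natCast_eq_zero_iff, hp.dvd_mul]
  rintro (h | h)
  · exact Nat.not_dvd_of_pos_of_lt (by omega) hg h
  · exact Nat.not_dvd_of_pos_of_lt (by omega) (by omega) h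

/-! ### The quadratic form -/

/-- The sum of `D (D + 1) / 2` over the positive differences `D = c k - c i`: the number of pairs
of a bead and an earlier gap on the `p`-abacus with beads in the first `c i` rows of runner `i`,
if `c` is weakly increasing. -/
def spread (p : ℕ) (c : ℕ → ℕ) : ℕ :=
  ∑ k ∈ Finset.range p, ∑ i ∈ Finset.range p, ∑ j ∈ Finset.range (c k - c i), (j + 1)

lemma two_mul_sum_range_succ_id (n : ℕ) : 2 * ∑ j ∈ Finset.range n, (j + 1) = n * (n + 1) := by
  induction n with
  | zero => simp
  | succ n ih => rw [Finset.sum_range_succ, mul_add, ih]; ring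

lemma two_mul_spread {p : ℕ} {c : ℕ → ℕ} (h : ∀ i, i + 1 < p → c i ≤ c (i + 1)) :
    2 * (spread p c : ℤ) = ∑ k ∈ Finset.range p, ∑ i ∈ Finset.range k,
      (((c k : ℤ) - c i) * (c k - c i) + ((c k : ℤ) - c i)) := by
  rw [spread, Nat.cast_sum, Finset.mul_sum]
  refine Finset.sum_congr rfl fun k hk => ?_
  rw [Finset.mem_range] at hk
  have hsub : Finset.range k ⊆ Finset.range p := Finset.range_subset_range.2 hk.le
  rw [← Finset.sum_subset hsub (fun i hi hi' => ?_), Nat.cast_sum, Finset.mul_sum]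
  · refine Finset.sum_congr rfl fun i hi => ?_
    rw [Finset.mem_range] at hi
    have h1 : c i ≤ c k := le_of_le_succ h hi.le hk
    have h2 := two_mul_sum_range_succ_id (c k - c i)
    zify [h1] at h2
    push_cast
    linarith
  · rw [Finset.mem_range] at hi hi'
    have h1 : c k ≤ c i := le_of_le_succ h (by omega) hi
    simp [Nat.sub_eq_zero_of_le h1]

lemma sum_sum_sub_mul_sub (u v : ℕ → ℤ) (n : ℕ) :
    ∑ k ∈ Finset.range n, ∑ i ∈ Finset.range k, (u k - u i) * (v k - v i) =
      n * ∑ k ∈ Finset.range n, u k * v k -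
        (∑ k ∈ Finset.range n, u k) * ∑ k ∈ Finset.range n, v k := by
  induction n with
  | zero => simp
  | succ n ih =>
    have h : ∑ i ∈ Finset.range n, (u n - u i) * (v n - v i) =
        n * (u n * v n) - u n * ∑ i ∈ Finset.range n, v i -
          (∑ i ∈ Finset.range n, u i) * v n + ∑ i ∈ Finset.range n, u i * v i := by
      simp only [sub_mul, mul_sub, Finset.sum_sub_distrib, Finset.sum_const, Finset.card_range,
        nsmul_eq_mul, Finset.mul_sum, Finset.sum_mul]
      ring
    simp only [Finset.sum_range_succ]
    rw [ih, h]
    push_cast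
    ring

lemma sum_sum_sub (v : ℕ → ℤ) (n : ℕ) :
    ∑ k ∈ Finset.range n, ∑ i ∈ Finset.range k, (v k - v i) =
      2 * ∑ k ∈ Finset.range n, k * v k - (n - 1) * ∑ k ∈ Finset.range n, v k := by
  induction n with
  | zero => simp
  | succ n ih =>
    have h : ∑ i ∈ Finset.range n, (v n - v i) = n * v n - ∑ i ∈ Finset.range n, v i := by
      simp [Finset.sum_sub_distrib]
    simp only [Finset.sum_range_succ]
    rw [ih, h]
    push_cast
    ring

/-- The sum of `v k - v i` over `i < g ≤ k < p`. -/
def cutSum (p : ℕ) (v : ℕ → ℤ) (g : ℕ) : ℤ :=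
  g * ∑ k ∈ Finset.range p, v k - p * ∑ k ∈ Finset.range g, v k

/-- Summation by parts: the form of `sum_sum_sub_mul_sub` in terms of the steps of `u` and the
cut sums of `v`. -/
lemma sum_step_mul_cutSum (q : ℕ) (u v : ℕ → ℤ) :
    ∑ g ∈ Finset.range q, (u (g + 1) - u g) * cutSum (q + 1) v (g + 1) =
      (q + 1 : ℕ) * ∑ k ∈ Finset.range (q + 1), u k * v k -
        (∑ k ∈ Finset.range (q + 1), u k) * ∑ k ∈ Finset.range (q + 1), v k := by
  have key : ∀ n : ℕ, ∑ g ∈ Finset.range n, (u (g + 1) - u g) * cutSum (q + 1) v (g + 1) =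
      (q + 1 : ℕ) * ∑ k ∈ Finset.range (n + 1), u k * v k -
        (∑ k ∈ Finset.range (n + 1), u k) * ∑ k ∈ Finset.range (q + 1), v k +
          u n * cutSum (q + 1) v (n + 1) := by
    intro n
    have hstep : ∀ k, cutSum (q + 1) v (k + 1) =
        cutSum (q + 1) v k + ∑ k ∈ Finset.range (q + 1), v k - (q + 1 : ℕ) * v k := by
      intro k
      simp only [cutSum, Finset.sum_range_succ _ k]
      push_cast
      ring
    induction n with
    | zero =>
      rw [hstep 0]
      simp [cutSum]
      ring
    | succ n ih =>
      rw [Finset.sum_range_succ, ih, hstep (n + 1), Finset.sum_range_succ _ (n + 1),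
        Finset.sum_range_succ u (n + 1)]
      ring
  rw [key q]
  simp [cutSum]

/-- Completing the square: in terms of `c k + k / p`, twice the spread is, up to a constant, a
quadratic form without linear part. So the difference of two spreads is a combination of the cut
sums of `d - c` with coefficients that are positive when `c` and `d` are weakly increasing. -/
lemma spread_sub_spread {q : ℕ} {c d : ℕ → ℕ} (hc : ∀ i, i + 1 < q + 1 → c i ≤ c (i + 1))
    (hd : ∀ i, i + 1 < q + 1 → d i ≤ d (i + 1)) :
    2 * (q + 1 : ℤ) * (spread (q + 1) d - spread (q + 1) c) =
      ∑ g ∈ Finset.range q,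
        ((q + 1) * ((d (g + 1) - d g : ℤ) + (c (g + 1) - c g)) + 2) *
          cutSum (q + 1) (fun k => (d k : ℤ) - c k) (g + 1) := by
  have h1 := two_mul_spread hc
  have h2 := two_mul_spread hd
  have h3 := sum_step_mul_cutSum q (fun k => (q + 1) * ((d k : ℤ) + c k) + 2 * k)
    (fun k => (d k : ℤ) - c k)
  simp only [Finset.sum_add_distrib, sum_sum_sub (fun k => (c k : ℤ)),
    sum_sum_sub (fun k => (d k : ℤ)), sum_sum_sub_mul_sub (fun k => (c k : ℤ)),
    sum_sum_sub_mul_sub (fun k => (d k : ℤ))] at h1 h2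
  have h4 : ∀ n : ℕ, 2 * ∑ k ∈ Finset.range (n + 1), (k : ℤ) = n * (n + 1) := by
    intro n
    induction n with
    | zero => simp
    | succ n ih => rw [Finset.sum_range_succ, mul_add, ih]; push_cast; ring
  have h5 : ∑ k ∈ Finset.range (q + 1),
      ((q + 1) * ((d k : ℤ) + c k) + 2 * k) * ((d k : ℤ) - c k) =
      (q + 1) * (∑ k ∈ Finset.range (q + 1), (d k : ℤ) * d k -
        ∑ k ∈ Finset.range (q + 1), (c k : ℤ) * c k) +
      2 * (∑ k ∈ Finset.range (q + 1), (k : ℤ) * d k -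
        ∑ k ∈ Finset.range (q + 1), (k : ℤ) * c k) := by
    rw [← Finset.sum_sub_distrib, ← Finset.sum_sub_distrib, Finset.mul_sum, Finset.mul_sum,
      ← Finset.sum_add_distrib]
    exact Finset.sum_congr rfl fun k _ => by ring
  rw [h5] at h3
  simp only [Finset.sum_add_distrib, Finset.sum_sub_distrib, ← Finset.mul_sum, h4] at h3
  push_cast at h1 h2 h3
  have h6 : ∑ g ∈ Finset.range q,
        ((q + 1) * ((d (g + 1) - d g : ℤ) + (c (g + 1) - c g)) + 2) *
          cutSum (q + 1) (fun k => (d k : ℤ) - c k) (g + 1) =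
      ∑ g ∈ Finset.range q,
        ((q + 1) * ((d (g + 1) : ℤ) + c (g + 1)) + 2 * (g + 1) -
          ((q + 1) * ((d g : ℤ) + c g) + 2 * g)) *
          cutSum (q + 1) (fun k => (d k : ℤ) - c k) (g + 1) :=
    Finset.sum_congr rfl fun g _ => by ring
  rw [h6, h3]
  linear_combination (q + 1 : ℤ) * h2 - (q + 1 : ℤ) * h1

lemma spread_le_spread {q : ℕ} {c d : ℕ → ℕ} (hc : ∀ i, i + 1 < q + 1 → c i ≤ c (i + 1))
    (hd : ∀ i, i + 1 < q + 1 → d i ≤ d (i + 1)) (h0 : c 0 = d 0)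
    (hP : ∀ g, g ≤ q → 0 ≤ cutSum (q + 1) (fun k => (d k : ℤ) - c k) g) :
    spread (q + 1) c ≤ spread (q + 1) d ∧
      (spread (q + 1) c = spread (q + 1) d → ∀ k, k < q + 1 → c k = d k) := by
  have hid := spread_sub_spread hc hd
  have hpos : ∀ g ∈ Finset.range q,
      0 < ((q : ℤ) + 1) * ((d (g + 1) - d g : ℤ) + (c (g + 1) - c g)) + 2 := by
    intro g hg
    rw [Finset.mem_range] at hg
    have h1 := hc g (by omega)
    have h2 := hd g (by omega)
    have h3 : (0 : ℤ) ≤ (d (g + 1) - d g : ℤ) + (c (g + 1) - c g) := by omega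
    positivity
  have hterm : ∀ g ∈ Finset.range q,
      0 ≤ ((q + 1) * ((d (g + 1) - d g : ℤ) + (c (g + 1) - c g)) + 2) *
          cutSum (q + 1) (fun k => (d k : ℤ) - c k) (g + 1) := fun g hg =>
    mul_nonneg (hpos g hg).le (hP _ (by rw [Finset.mem_range] at hg; omega))
  constructor
  · have := Finset.sum_nonneg hterm
    rw [← hid] at this
    have h : (0 : ℤ) ≤ spread (q + 1) d - spread (q + 1) c :=
      nonneg_of_mul_nonneg_right this (by positivity)
    omega
  · intro heq
    rw [heq, sub_self, mul_zero] at hid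
    have hz := (Finset.sum_eq_zero_iff_of_nonneg hterm).1 hid.symm
    have hP0 : ∀ g, g ≤ q + 1 → cutSum (q + 1) (fun k => (d k : ℤ) - c k) g = 0 := by
      intro g hg
      rcases Nat.eq_zero_or_pos g with rfl | hg0
      · simp [cutSum]
      rcases hg.eq_or_lt with rfl | hlt
      · simp [cutSum]
      obtain ⟨g, rfl⟩ : ∃ n, g = n + 1 := ⟨g - 1, by omega⟩
      have hm : g ∈ Finset.range q := Finset.mem_range.2 (by omega)
      exact (mul_eq_zero.1 (hz g hm)).resolve_left (hpos g hm).ne'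
    have hstep : ∀ k, k < q + 1 → ∑ k ∈ Finset.range (q + 1), ((d k : ℤ) - c k) =
        (q + 1 : ℕ) * ((d k : ℤ) - c k) := by
      intro k hk
      have h1 := hP0 k (by omega)
      have h2 := hP0 (k + 1) (by omega)
      rw [cutSum] at h1 h2
      rw [Finset.sum_range_succ _ k] at h2
      push_cast at h1 h2 ⊢
      linarith
    intro k hk
    have h1 := hstep 0 (by omega)
    rw [h0, sub_self, mul_zero] at h1
    have h2 := hstep k hk
    rw [h1, eq_comm, mul_eq_zero] at h2
    have h3 := h2.resolve_left (by positivity)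
    omega

/-- A sequence with steps `a (k + 1) + b k` has nonnegative cut sums if, for each `k`, the cut
sums that `a k` and `b k` contribute together are nonnegative. -/
lemma cutSum_nonneg {p : ℕ} {v a b : ℕ → ℤ} (ha0 : a 0 = 0) (hv0 : v 0 = 0)
    (hv : ∀ k, k + 1 < p → v (k + 1) = v k + a (k + 1) + b k)
    (hl : ∀ k, k < p → 0 ≤ k * a k + (k + 1) * b k)
    (hr : ∀ k, k < p → 0 ≤ (p - k) * a k + (p - k - 1) * b k) {g : ℕ} (hg : g ≤ p) :
    0 ≤ cutSum p v g := by
  have hva : ∀ k, k < p → v k = ∑ i ∈ Finset.range k, (a i + b i) + a k := by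
    intro k
    induction k with
    | zero => intro _; simp [ha0, hv0]
    | succ k ih => intro hk; rw [hv k hk, ih (by omega), Finset.sum_range_succ]; ring
  have hS : ∀ n, n ≤ p → ∑ k ∈ Finset.range n, v k =
      n * ∑ k ∈ Finset.range n, (a k + b k) -
        ∑ k ∈ Finset.range n, ((k : ℤ) * a k + (k + 1) * b k) := by
    intro n
    induction n with
    | zero => intro _; simp
    | succ n ih =>
      intro hn
      rw [Finset.sum_range_succ, ih (by omega), hva n (by omega), Finset.sum_range_succ,
        Finset.sum_range_succ _ n]
      push_cast
      ring
  have h1 : cutSum p v g =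
      (p - g) * ∑ k ∈ Finset.range g, ((k : ℤ) * a k + (k + 1) * b k) +
      g * ∑ k ∈ Finset.Ico g p, (((p : ℤ) - k) * a k + (p - k - 1) * b k) := by
    have h2 : ∑ k ∈ Finset.Ico g p, (((p : ℤ) - k) * a k + (p - k - 1) * b k) =
        p * ∑ k ∈ Finset.Ico g p, (a k + b k) -
          ∑ k ∈ Finset.Ico g p, ((k : ℤ) * a k + (k + 1) * b k) := by
      rw [Finset.mul_sum, ← Finset.sum_sub_distrib]
      exact Finset.sum_congr rfl fun k _ => by ring
    rw [h2, Finset.sum_Ico_eq_sub _ hg, Finset.sum_Ico_eq_sub _ hg, cutSum, hS p le_rfl, hS g hg]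
    ring
  rw [h1]
  have hgp : (0 : ℤ) ≤ p - g := by omega
  refine add_nonneg (mul_nonneg hgp (Finset.sum_nonneg fun k hk => hl k ?_))
    (mul_nonneg (Int.natCast_nonneg g) (Finset.sum_nonneg fun k hk => hr k ?_))
  · rw [Finset.mem_range] at hk; omega
  · exact (Finset.mem_Ico.1 hk).2

/-! ### The optimal runner profile -/

/-- The boundary values of the best pairs: `b 0 = 0`, since the walk starts at `0`, and
`a (p - 1) = 1`, the smallest value that keeps the walk away from `0`. -/
lemma exists_bestPair_sequence {p : ℕ} (hp : p.Prime) (hodd : Odd p) :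
    ∃ a b : ℕ → ℕ, b 0 = 0 ∧ a (p - 1) = 1 ∧
      ∀ k l, 0 < k → 0 < l → k + l + 1 = p → IsBestPair k l (a k) (b k) ∧
        2 * (a k + b k) ≤ p + 1 ∧ (Even k → 2 * (a k + b k) + 1 ≤ p) := by
  have h : ∀ k, ∃ a b : ℕ, ∀ l, 0 < k → 0 < l → k + l + 1 = p → IsBestPair k l a b ∧
        2 * (a + b) ≤ p + 1 ∧ (Even k → 2 * (a + b) + 1 ≤ p) := by
    intro k
    by_cases hk : 0 < k ∧ k + 1 < p
    · obtain ⟨l, rfl⟩ : ∃ l, p = k + l + 1 := ⟨p - 1 - k, by omega⟩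
      obtain ⟨a, b, h1, h2, h3⟩ := exists_isBestPair hk.1 (by omega) hp hodd
      refine ⟨a, b, fun l' _ _ hl' => ?_⟩
      obtain rfl : l' = l := by omega
      exact ⟨h1, h2, fun he => by have := h3 he; omega⟩
    · exact ⟨0, 0, fun l h1 h2 h3 => absurd ⟨h1, by omega⟩ hk⟩
  choose a b hab using h
  have := hp.two_le
  refine ⟨fun k => if k = p - 1 then 1 else a k, fun k => if k = 0 then 0 else b k, by simp,
    by simp, fun k l hk hl hkl => ?_⟩
  beta_reduce
  rw [if_neg (by omega), if_neg (by omega)]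
  exact hab k l hk hl hkl

theorem exists_optimal_runnerProfile {p : ℕ} (hp : p.Prime) (hodd : Odd p) :
    ∃ d : ℕ → ℕ, IsRunnerProfile p d ∧
      (∀ c, IsRunnerProfile p c → spread p c ≤ spread p d ∧
        (spread p c = spread p d → ∀ k, k < p → c k = d k)) ∧
      (∀ i, 2 ≤ i → i ≤ p - 2 → d i - d (i - 1) = d (p - i) - d (p - i - 1)) ∧
      d 1 - d 0 = d (p - 1) - d (p - 1 - 1) + 1 := by
  obtain ⟨a, b, hb0, ha1, hbest⟩ := exists_bestPair_sequence hp hodd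
  have hp3 : 3 ≤ p := by
    have := hp.two_le
    rcases hodd with ⟨w, hw⟩
    omega
  -- the two pairs that meet at a step have sums at most `(p + 1) / 2` and `(p - 1) / 2`
  have hsum : ∀ g, g + 1 < p → a (g + 1) + b g < p := by
    intro g hg
    rcases Nat.eq_zero_or_pos g with rfl | hg0
    · obtain ⟨h1, h2, -⟩ := hbest 1 (p - 2) (by omega) (by omega) (by omega)
      have := h1.right_pos
      rw [hb0, zero_add]
      omega
    obtain ⟨h1, h2, h3⟩ := hbest g (p - 1 - g) hg0 (by omega) (by omega)
    have h1' := h1.left_pos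
    rcases (show g + 1 ≤ p - 1 by omega).eq_or_lt with heq | hlt
    · rw [heq, ha1]; omega
    · obtain ⟨h4, h5, h6⟩ := hbest (g + 1) (p - 1 - (g + 1)) (by omega) (by omega) (by omega)
      have h4' := h4.right_pos
      omega
  have hswap : ∀ k l, 0 < k → 0 < l → k + l + 1 = p → a k = b l ∧ b k = a l := by
    intro k l hk hl hkl
    have h1 := (hbest k l hk hl hkl).1
    have h2 := (hbest l k hl hk (by omega)).1.swap
    exact h1.unique h2
  set d : ℕ → ℕ := fun k => ∑ g ∈ Finset.range k, (p - a (g + 1) - b g) with hd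
  have hstep : ∀ g, d (g + 1) = d g + (p - a (g + 1) - b g) := fun g => by
    rw [hd]; exact Finset.sum_range_succ _ g
  have hd0 : d 0 = 0 := by simp [hd]
  have hle : ∀ i, i + 1 < p → d i ≤ d (i + 1) := fun i _ => by rw [hstep]; omega
  have hwalk : ∀ g, g + 1 < p → 0 < a (g + 1) ∧ d (g + 1) + a (g + 1) + b g = d g + p := by
    intro g hg
    have h1 := hsum g hg
    refine ⟨?_, by rw [hstep]; omega⟩
    rcases (show g + 1 ≤ p - 1 by omega).eq_or_lt with heq | hlt
    · rw [heq, ha1]; exact one_pos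
    · exact (hbest (g + 1) (p - 1 - (g + 1)) (by omega) (by omega) (by omega)).1.left_pos
  refine ⟨d, isRunnerProfile_of_walk hp hd0 hb0 hle hwalk fun k hk hkp => ?_, fun c hc => ?_,
    fun i hi hip => ?_, ?_⟩
  · obtain ⟨l, hl⟩ : ∃ l, k + l + 1 = p := ⟨p - 1 - k, by omega⟩
    have := (hbest k l hk (by omega) hl).1.dvd
    rwa [hl] at this
  · obtain ⟨a', b', hb0', hwalk', hdvd'⟩ := hc.exists_walk hp
    obtain ⟨q, rfl⟩ : ∃ q, p = q + 1 := ⟨p - 1, by omega⟩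
    refine spread_le_spread hc.le_succ hle (hc.zero.trans hd0.symm) fun g hg => ?_
    refine cutSum_nonneg (a := fun k => if k = 0 then 0 else (a' k : ℤ) - a k)
      (b := fun k => if k = q then 0 else (b' k : ℤ) - b k) (by simp)
      (by simp [hc.zero, hd0]) (fun k hk => ?_) (fun k hk => ?_) (fun k hk => ?_)
      (show g ≤ q + 1 by omega)
    · have h1 := (hwalk k hk).2
      have h2 := (hwalk' k hk).2
      rw [if_neg (by omega), if_neg (by omega)]
      omega
    all_goals
      rcases Nat.eq_zero_or_pos k with rfl | hk0
      · simp [hb0, hb0']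
      rcases (show k ≤ q by omega).eq_or_lt with rfl | hkq
      · have h1 : 0 < a' k := by
          have := (hwalk' (k - 1) (by omega)).1
          rwa [Nat.sub_add_cancel hk0] at this
        have h2 : a k = 1 := by simpa using ha1
        have h3 : (0 : ℤ) ≤ (a' k : ℤ) - a k := by omega
        rw [if_neg (by omega), if_pos rfl]
        push_cast
        nlinarith
      obtain ⟨l, rfl⟩ : ∃ l, q = k + l := ⟨q - k, by omega⟩
      have h1 := (hbest k l hk0 (by omega) rfl).1
      have h2 : 0 < a' k := by
        have := (hwalk' (k - 1) (by omega)).1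
        rwa [Nat.sub_add_cancel hk0] at this
      have h3 := h1.le_left (a' k) (b' k) (by omega) (hdvd' k hk0 (by omega))
      have h4 := h1.le_right (a' k) (b' k) (by omega) (hdvd' k hk0 (by omega))
      rw [if_neg (by omega), if_neg (by omega)]
      zify at h3 h4
      push_cast
      linarith
  · obtain ⟨g, rfl⟩ : ∃ g, i = g + 1 := ⟨i - 1, by omega⟩
    obtain ⟨l, hl⟩ : ∃ l, p - (g + 1) = l + 1 := ⟨p - (g + 1) - 1, by omega⟩
    rw [hl, Nat.add_sub_cancel, Nat.add_sub_cancel, hstep, hstep, Nat.add_sub_cancel_left,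
      Nat.add_sub_cancel_left, (hswap (g + 1) l (by omega) (by omega) (by omega)).1,
      (hswap (l + 1) g (by omega) (by omega) (by omega)).1]
    omega
  · obtain ⟨l, hl⟩ : ∃ l, p - 1 = l + 1 := ⟨p - 2, by omega⟩
    have h1 := hsum 0 (by omega)
    rw [hl, Nat.add_sub_cancel, hstep, hstep, Nat.add_sub_cancel_left, Nat.add_sub_cancel_left,
      ← hl, ha1, hb0, (hswap l 1 (by omega) one_pos (by omega)).2]
    rw [hb0] at h1
    simp only [zero_add, add_zero] at h1 ⊢
    omega

/-! ### Partitions and their bead sets -/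

/-- The number of gaps below position `x` when there are beads in the positions of `B`. -/
def gapsBelow (B : Finset ℕ) (x : ℕ) : ℕ := ((Finset.range x).filter (· ∉ B)).card

namespace YoungDiagram

variable {μ ν : YoungDiagram}

/-- The position of the bead of the `k`-th part. -/
def beadPos (μ : YoungDiagram) (k : ℕ) : ℕ := μ.rowLen k + (μ.colLen 0 - 1 - k)

lemma mem_beads {x : ℕ} : x ∈ μ.beads ↔ ∃ k < μ.colLen 0, μ.beadPos k = x := by
  simp [beads, beadPos]

lemma beadPos_lt_beadPos {i k : ℕ} (hik : i < k) (hk : k < μ.colLen 0) :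
    μ.beadPos k < μ.beadPos i := by
  have := μ.rowLen_anti i k hik.le
  unfold beadPos
  omega

lemma beadPos_injOn : Set.InjOn μ.beadPos {k | k < μ.colLen 0} := by
  intro i hi k hk h
  rcases lt_trichotomy i k with hik | hik | hik
  · exact absurd h (beadPos_lt_beadPos hik hk).ne'
  · exact hik
  · exact absurd h (beadPos_lt_beadPos hik hi).ne

lemma rowLen_pos {k : ℕ} (hk : k < μ.colLen 0) : 0 < μ.rowLen k :=
  mem_iff_lt_rowLen.1 (mem_iff_lt_colLen.2 hk)

lemma rowLen_eq_zero {k : ℕ} (hk : μ.colLen 0 ≤ k) : μ.rowLen k = 0 := by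
  by_contra h
  exact absurd (mem_iff_lt_colLen.1 (mem_iff_lt_rowLen.2 (Nat.pos_of_ne_zero h))) (not_lt.2 hk)

lemma zero_notMem_beads : 0 ∉ μ.beads := by
  rw [mem_beads]
  rintro ⟨k, hk, h⟩
  have := rowLen_pos hk
  unfold beadPos at h
  omega

lemma gapsBelow_beadPos {k : ℕ} (hk : k < μ.colLen 0) :
    gapsBelow μ.beads (μ.beadPos k) = μ.rowLen k := by
  have h1 : (Finset.range (μ.beadPos k)).filter (· ∈ μ.beads) =
      (Finset.Ico (k + 1) (μ.colLen 0)).image μ.beadPos := by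
    ext x
    simp only [Finset.mem_filter, Finset.mem_range, mem_beads, Finset.mem_image, Finset.mem_Ico]
    constructor
    · rintro ⟨hx, i, hi, rfl⟩
      refine ⟨i, ⟨?_, hi⟩, rfl⟩
      by_contra hcon
      rcases (show i ≤ k by omega).eq_or_lt with rfl | hlt
      · exact lt_irrefl _ hx
      · exact lt_asymm hx (beadPos_lt_beadPos hlt hk)
    · rintro ⟨i, ⟨hki, hi⟩, rfl⟩
      exact ⟨beadPos_lt_beadPos hki hi, i, hi, rfl⟩
  have h2 : ((Finset.range (μ.beadPos k)).filter (· ∈ μ.beads)).card =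
      μ.colLen 0 - (k + 1) := by
    rw [h1, Finset.card_image_of_injOn, Nat.card_Ico]
    exact beadPos_injOn.mono fun i hi => (Finset.mem_Ico.1 hi).2
  have h3 := Finset.card_filter_add_card_filter_not (s := Finset.range (μ.beadPos k))
    (· ∈ μ.beads)
  rw [h2, Finset.card_range] at h3
  unfold gapsBelow
  unfold beadPos at h3 ⊢
  omega

lemma card_eq_sum_gapsBelow : μ.card = ∑ x ∈ μ.beads, gapsBelow μ.beads x := by
  have h1 : μ.card = ∑ k ∈ Finset.range (μ.colLen 0), μ.rowLen k := by
    rw [YoungDiagram.card, Finset.card_eq_sum_card_fiberwise (f := Prod.fst)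
      (t := Finset.range (μ.colLen 0))]
    · exact Finset.sum_congr rfl fun k _ => (rowLen_eq_card μ).symm
    · rintro ⟨i, j⟩ hc
      have h : (i, 0) ∈ μ := μ.up_left_mem le_rfl (Nat.zero_le j) (mem_cells _ |>.1 hc)
      exact Finset.mem_coe.2 (Finset.mem_range.2 (mem_iff_lt_colLen.1 h))
  have h2 : μ.beads = (Finset.range (μ.colLen 0)).image μ.beadPos := rfl
  rw [h1]
  conv_rhs => rw [h2]
  rw [Finset.sum_image (beadPos_injOn.mono fun i hi => Finset.mem_range.1 hi)]
  refine Finset.sum_congr rfl fun k hk => ?_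
  rw [← h2, gapsBelow_beadPos (Finset.mem_range.1 hk)]

lemma isPPrime_iff {p : ℕ} : μ.IsPPrime p ↔ ∀ x ∈ μ.beads, ¬ p ∣ gapsBelow μ.beads x := by
  simp only [IsPPrime, rowLens, List.mem_map, List.mem_range, mem_beads]
  constructor
  · rintro h x ⟨k, hk, rfl⟩
    rw [gapsBelow_beadPos hk]
    exact h _ ⟨k, hk, rfl⟩
  · rintro h x ⟨k, hk, rfl⟩
    rw [← gapsBelow_beadPos hk]
    exact h _ ⟨k, hk, rfl⟩

lemma colLen_le_colLen_zero (j : ℕ) : μ.colLen j ≤ μ.colLen 0 := μ.colLen_anti 0 j (Nat.zero_le j)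

/-- The gaps are at the positions `j + ℓ - colLen j`, where `ℓ` is the number of parts. -/
lemma notMem_beads_iff {y : ℕ} :
    y ∉ μ.beads ↔ ∃ j, y + μ.colLen j = j + μ.colLen 0 := by
  constructor
  · intro hy
    have hex : ∃ c, μ.colLen 0 ≤ c ∨ μ.beadPos c < y := ⟨_, Or.inl le_rfl⟩
    have hc := Nat.find_spec hex
    have hmin : ∀ k < Nat.find hex, k < μ.colLen 0 ∧ y < μ.beadPos k := by
      intro k hk
      have h := Nat.find_min hex hk
      rw [not_or, not_le, not_lt] at h
      exact ⟨h.1, h.2.lt_of_ne fun h' => hy (mem_beads.2 ⟨k, h.1, h'.symm⟩)⟩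
    have hcl : Nat.find hex ≤ μ.colLen 0 := Nat.find_min' hex (Or.inl le_rfl)
    set c := Nat.find hex with hcdef
    have hyc : μ.colLen 0 ≤ y + c := by
      rcases hc with h | h
      · omega
      · unfold beadPos at h; omega
    refine ⟨y + c - μ.colLen 0, ?_⟩
    have hcol : μ.colLen (y + c - μ.colLen 0) = c := by
      apply le_antisymm
      · by_contra hcon
        have h1 := mem_iff_lt_rowLen.1 (mem_iff_lt_colLen.2 (not_le.1 hcon))
        rcases hc with h | h
        · rw [rowLen_eq_zero h] at h1; omega
        · unfold beadPos at h; omega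
      · rcases Nat.eq_zero_or_pos c with h0 | h0
        · omega
        have h1 := hmin (c - 1) (by omega)
        have h2 : c - 1 < μ.colLen (y + c - μ.colLen 0) := by
          rw [← mem_iff_lt_colLen, mem_iff_lt_rowLen]
          unfold beadPos at h1
          omega
        omega
    rw [hcol]
    omega
  · rintro ⟨j, hj⟩ hy
    obtain ⟨k, hk, rfl⟩ := mem_beads.1 hy
    have h1 : k < μ.colLen j ↔ j < μ.rowLen k := by
      rw [← mem_iff_lt_colLen, mem_iff_lt_rowLen]
    unfold beadPos at hj
    omega

/-- The hook lengths are the distances between a bead and an earlier gap. -/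
lemma isPCore_iff {p : ℕ} (hp : 0 < p) :
    μ.IsPCore p ↔ ∀ x, x + p ∈ μ.beads → x ∈ μ.beads := by
  have hhook : ∀ {i j y : ℕ}, (i, j) ∈ μ → y + μ.colLen j = j + μ.colLen 0 →
      y + μ.hookLength i j = μ.beadPos i := by
    intro i j y hij hy
    have h1 := mem_iff_lt_colLen.1 hij
    have h2 := mem_iff_lt_rowLen.1 hij
    have h3 := μ.colLen_le_colLen_zero j
    unfold hookLength beadPos
    omega
  constructor
  · intro h x hx
    by_contra hcon
    obtain ⟨j, hj⟩ := notMem_beads_iff.1 hcon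
    obtain ⟨i, hi, hix⟩ := mem_beads.1 hx
    have hij : (i, j) ∈ μ := by
      by_contra hn
      have h1 := mt mem_iff_lt_colLen.2 hn
      have h2 := mt mem_iff_lt_rowLen.2 hn
      unfold beadPos at hix
      omega
    have h1 := hhook hij hj
    exact h i j hij ⟨1, by omega⟩
  · rintro h i j hij ⟨t, ht⟩
    have hflush : ∀ t y, y + p * t ∈ μ.beads → y ∈ μ.beads := by
      intro t
      induction t with
      | zero => intro y hy; simpa using hy
      | succ t ih => intro y hy; exact ih y (h _ (by rwa [mul_add, mul_one, ← add_assoc] at hy))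
    have h3 := μ.colLen_le_colLen_zero j
    have hgap : j + μ.colLen 0 - μ.colLen j + μ.colLen j = j + μ.colLen 0 := by omega
    have h1 := hhook hij hgap
    refine notMem_beads_iff.2 ⟨j, hgap⟩ (hflush t _ ?_)
    rw [← ht, h1]
    exact mem_beads.2 ⟨i, mem_iff_lt_colLen.1 (μ.up_left_mem le_rfl (Nat.zero_le j) hij), rfl⟩

lemma card_beads : μ.beads.card = μ.colLen 0 := by
  rw [beads, Finset.card_image_of_injOn, Finset.card_range]
  exact beadPos_injOn.mono fun i hi => Finset.mem_range.1 hi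

lemma beads_injective : Function.Injective beads := by
  intro μ ν h
  have hn : μ.colLen 0 = ν.colLen 0 := by rw [← card_beads, ← card_beads, h]
  have hemb : ∀ {ξ : YoungDiagram} (hξ : μ.beads = ξ.beads) (hc : μ.beads.card = ξ.colLen 0),
      (fun i : Fin (ξ.colLen 0) => ξ.beadPos (ξ.colLen 0 - 1 - i)) =
        μ.beads.orderEmbOfFin hc := by
    intro ξ hξ hc
    apply Finset.orderEmbOfFin_unique
    · intro i
      rw [hξ]
      exact mem_beads.2 ⟨_, by omega, rfl⟩
    · intro i k hik
      have : (i : ℕ) < k := hik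
      exact beadPos_lt_beadPos (by omega) (by omega)
  have hpos : ∀ k, k < μ.colLen 0 → μ.beadPos k = ν.beadPos k := by
    intro k hk
    have h1 := congrFun (hemb rfl card_beads) ⟨μ.colLen 0 - 1 - k, by omega⟩
    have h2 := congrFun (hemb h (card_beads.trans hn)) ⟨ν.colLen 0 - 1 - k, by omega⟩
    simp only at h1 h2
    rw [show μ.colLen 0 - 1 - (μ.colLen 0 - 1 - k) = k by omega] at h1
    rw [show ν.colLen 0 - 1 - (ν.colLen 0 - 1 - k) = k by omega] at h2
    rw [h1, h2]
    simp only [Finset.orderEmbOfFin_apply, hn]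
    rfl
  have hrow : ∀ k, μ.rowLen k = ν.rowLen k := by
    intro k
    by_cases hk : k < μ.colLen 0
    · have := hpos k hk
      unfold beadPos at this
      omega
    · rw [rowLen_eq_zero (not_lt.1 hk), rowLen_eq_zero (hn ▸ not_lt.1 hk)]
  ext ⟨i, j⟩
  rw [mem_cells, mem_cells, mem_iff_lt_rowLen, mem_iff_lt_rowLen, hrow]

/-- Every finite set of positive integers is the bead set of a partition. -/
lemma exists_beads_eq {B : Finset ℕ} (hB : 0 ∉ B) : ∃ μ : YoungDiagram, μ.beads = B := by
  set e : ℕ → ℕ := Nat.nth (· ∈ B) with he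
  have hf : (Set.ofPred (· ∈ B)).Finite := B.finite_toSet
  have hfc : hf.toFinset.card = B.card := by
    congr 1; ext x; exact hf.mem_toFinset
  have hmem : ∀ i, i < B.card → e i ∈ B := fun i hi =>
    Nat.nth_mem_of_lt_card hf (hfc.symm ▸ hi)
  have hlt : ∀ i k, i < k → k < B.card → e i < e k := fun i k hik hk =>
    Nat.nth_lt_nth_of_lt_card hf hik (hfc.symm ▸ hk)
  have hpos : ∀ i, i < B.card → i < e i := by
    intro i
    induction i with
    | zero => intro h; exact Nat.pos_of_ne_zero fun h0 => hB (h0 ▸ hmem 0 h)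
    | succ i ih =>
      intro h
      have h1 := ih (by omega)
      have h2 := hlt i (i + 1) (by omega) h
      omega
  have hmono : ∀ i k, i ≤ k → k < B.card → e i - i ≤ e k - k := by
    intro i k hik
    induction k, hik using Nat.le_induction with
    | base => intro _; exact le_rfl
    | succ k hk ih =>
      intro h
      have h1 := ih (by omega)
      have h2 := hlt k (k + 1) (by omega) h
      have h3 := hpos k (by omega)
      omega
  set r : ℕ → ℕ := fun k => if k < B.card then e (B.card - 1 - k) - (B.card - 1 - k) else 0
    with hr
  have hanti : ∀ i k, i ≤ k → r k ≤ r i := by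
    intro i k hik
    simp only [hr]
    by_cases hk : k < B.card
    · rw [if_pos hk, if_pos (by omega)]
      exact hmono _ _ (by omega) (by omega)
    · rw [if_neg hk]; exact Nat.zero_le _
  have hsort : ((List.range B.card).map r).SortedGE :=
    (List.pairwise_le_range.map _ hanti).sortedGE
  have hlens := rowLens_ofRowLens_eq_self (hw := hsort) (by
    intro x hx
    obtain ⟨k, hk, rfl⟩ := List.mem_map.1 hx
    rw [List.mem_range] at hk
    simp only [hr, if_pos hk]
    have := hpos (B.card - 1 - k) (by omega)
    omega)
  refine ⟨ofRowLens _ hsort, ?_⟩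
  set μ := ofRowLens _ hsort
  have hcol : μ.colLen 0 = B.card := by
    rw [← length_rowLens, hlens, List.length_map, List.length_range]
  have hrow : ∀ k, k < B.card → μ.rowLen k = r k := by
    intro k hk
    have h1 : μ.rowLens[k]? = some (μ.rowLen k) := by simp [rowLens, hcol, hk]
    rw [hlens] at h1
    simpa [hk, eq_comm] using h1
  refine Finset.eq_of_subset_of_card_le (fun x hx => ?_) (by rw [card_beads, hcol])
  obtain ⟨k, hk, rfl⟩ := mem_beads.1 hx
  rw [hcol] at hk
  have h1 := hpos (B.card - 1 - k) (by omega)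
  have h2 : μ.beadPos k = e (B.card - 1 - k) := by
    rw [beadPos, hrow k hk, hcol]
    simp only [hr, if_pos hk]
    omega
  rw [h2]
  exact hmem _ (by omega)

end YoungDiagram

/-! ### The abacus -/

/-- The set `B` consists of the beads in the first `b r` rows of runner `r`, for `r < p`. -/
def HasRunnerCounts (p : ℕ) (b : ℕ → ℕ) (B : Finset ℕ) : Prop :=
  ∀ j r, r < p → (j * p + r ∈ B ↔ j < b r)

lemma exists_hasRunnerCounts {p : ℕ} (hp : 0 < p) {B : Finset ℕ}
    (hB : ∀ x, x + p ∈ B → x ∈ B) : ∃ b, HasRunnerCounts p b B := by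
  have hex : ∀ r, ∃ j, j * p + r ∉ B := by
    intro r
    obtain ⟨N, hN⟩ := B.bddAbove
    refine ⟨N + 1, fun h => ?_⟩
    have h1 := hN (Finset.mem_coe.2 h)
    have h2 : (N + 1) * 1 ≤ (N + 1) * p := Nat.mul_le_mul_left _ hp
    omega
  refine ⟨fun r => Nat.find (hex r), fun j r _ => ⟨fun h => ?_, fun h => ?_⟩⟩
  · by_contra hcon
    replace hcon : Nat.find (hex r) ≤ j := not_lt.1 hcon
    have hdown : ∀ i, i + Nat.find (hex r) ≤ j → (j - i) * p + r ∈ B := by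
      intro i
      induction i with
      | zero => intro _; exact h
      | succ i ih =>
        intro hi
        refine hB _ ?_
        have := ih (by omega)
        rw [show j - i = j - (i + 1) + 1 by omega, add_mul, one_mul] at this
        rwa [add_right_comm]
    have h1 := hdown (j - Nat.find (hex r)) (by omega)
    rw [show j - (j - Nat.find (hex r)) = Nat.find (hex r) by omega] at h1
    exact Nat.find_spec (hex r) h1
  · exact not_not.1 (Nat.find_min (hex r) h)

lemma mul_add_injective {p : ℕ} (hp : 0 < p) (r : ℕ) :
    Function.Injective fun j => j * p + r := fun _ _ h =>
  Nat.eq_of_mul_eq_mul_right hp (Nat.add_right_cancel h)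

lemma mul_add_mod_eq {p r : ℕ} (hr : r < p) (j : ℕ) : (j * p + r) % p = r := by
  rw [mul_comm, Nat.mul_add_mod, Nat.mod_eq_of_lt hr]

lemma div_mul_add_eq {p x r : ℕ} (h : x % p = r) : x / p * p + r = x := by
  rw [← h, Nat.div_add_mod']

section

variable {p : ℕ} {b : ℕ → ℕ} {B : Finset ℕ}

/-- The number of gaps before the position in row `j` on runner `s`, counted by runners. -/
lemma HasRunnerCounts.gapsBelow_eq (h : HasRunnerCounts p b B) (hp : 0 < p) (j : ℕ) {s : ℕ}
    (hs : s < p) :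
    gapsBelow B (j * p + s) = ∑ r ∈ Finset.range p, (j + (if r < s then 1 else 0) - b r) := by
  rw [gapsBelow, Finset.card_eq_sum_card_fiberwise (f := (· % p)) (t := Finset.range p)
    fun x _ => Finset.mem_coe.2 (Finset.mem_range.2 (Nat.mod_lt x hp))]
  refine Finset.sum_congr rfl fun r hr => ?_
  rw [Finset.mem_range] at hr
  have hset : ((Finset.range (j * p + s)).filter (· ∉ B)).filter (fun x => x % p = r) =
      (Finset.Ico (b r) (j + (if r < s then 1 else 0))).image fun i => i * p + r := by
    have hlt : ∀ i, i * p + r < j * p + s ↔ i < j + (if r < s then 1 else 0) := by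
      intro i
      constructor
      · intro hi
        by_contra hcon
        split_ifs at hcon with hrs
        · have : (j + 1) * p ≤ i * p := Nat.mul_le_mul_right _ (by omega)
          rw [add_mul, one_mul] at this
          omega
        · have : j * p ≤ i * p := Nat.mul_le_mul_right _ (by omega)
          omega
      · intro hi
        split_ifs at hi with hrs
        · have : i * p ≤ j * p := Nat.mul_le_mul_right _ (by omega)
          omega
        · have : (i + 1) * p ≤ j * p := Nat.mul_le_mul_right _ (by omega)
          rw [add_mul, one_mul] at this
          omega
    ext x
    simp only [Finset.mem_filter, Finset.mem_range, Finset.mem_image, Finset.mem_Ico]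
    constructor
    · rintro ⟨⟨hx, hxB⟩, hxr⟩
      have hxe := div_mul_add_eq hxr
      rw [← hxe] at hx hxB
      rw [h _ _ hr, not_lt] at hxB
      exact ⟨x / p, ⟨hxB, (hlt _).1 hx⟩, hxe⟩
    · rintro ⟨i, ⟨hi, hij⟩, rfl⟩
      exact ⟨⟨(hlt i).2 hij, by rw [h _ _ hr]; omega⟩, mul_add_mod_eq hr i⟩
  rw [hset, Finset.card_image_of_injective _ (mul_add_injective hp r), Nat.card_Ico]

lemma HasRunnerCounts.sum_eq (h : HasRunnerCounts p b B) (hp : 0 < p) (f : ℕ → ℕ) :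
    ∑ x ∈ B, f x = ∑ s ∈ Finset.range p, ∑ j ∈ Finset.range (b s), f (j * p + s) := by
  rw [← Finset.sum_fiberwise_of_maps_to (g := (· % p)) (t := Finset.range p)
    fun x _ => Finset.mem_range.2 (Nat.mod_lt x hp)]
  refine Finset.sum_congr rfl fun s hs => ?_
  rw [Finset.mem_range] at hs
  have hset : B.filter (fun x => x % p = s) =
      (Finset.range (b s)).image fun i => i * p + s := by
    ext x
    simp only [Finset.mem_filter, Finset.mem_range, Finset.mem_image]
    constructor
    · rintro ⟨hx, hxs⟩
      have hxe := div_mul_add_eq hxs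
      rw [← hxe, h _ _ hs] at hx
      exact ⟨x / p, hx, hxe⟩
    · rintro ⟨i, hi, rfl⟩
      exact ⟨(h _ _ hs).2 hi, mul_add_mod_eq hs i⟩
  rw [hset, Finset.sum_image (mul_add_injective hp s).injOn]

lemma sum_range_succ_sub (n m : ℕ) :
    ∑ j ∈ Finset.range n, (j + 1 - m) = ∑ j ∈ Finset.range (n - m), (j + 1) := by
  induction n with
  | zero => simp
  | succ n ih =>
    rw [Finset.sum_range_succ, ih]
    rcases Nat.lt_or_ge n m with h | h
    · rw [Nat.sub_eq_zero_of_le (show n ≤ m by omega),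
        Nat.sub_eq_zero_of_le (show n + 1 ≤ m by omega)]
      rfl
    · rw [show n + 1 - m = n - m + 1 by omega, Finset.sum_range_succ]

lemma sum_range_sub_add (n m : ℕ) :
    ∑ j ∈ Finset.range n, (j - m) + (n - m) = ∑ j ∈ Finset.range (n - m), (j + 1) := by
  rw [← sum_range_succ_sub]
  induction n with
  | zero => simp
  | succ n ih =>
    rw [Finset.sum_range_succ, Finset.sum_range_succ, ← ih]

/-- A pair of runners contributes `D (D + 1) / 2` pairs of a bead and an earlier gap, where `D` is
the difference of the bead counts, less `D` if the fuller runner is not to the right. -/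
lemma HasRunnerCounts.sum_gapsBelow_add (h : HasRunnerCounts p b B) (hp : 0 < p) :
    ∑ x ∈ B, gapsBelow B x +
      ∑ s ∈ Finset.range p, ∑ r ∈ Finset.range p, (if r < s then 0 else b s - b r) =
        spread p b := by
  rw [h.sum_eq hp, spread, ← Finset.sum_add_distrib]
  refine Finset.sum_congr rfl fun s hs => ?_
  rw [Finset.sum_congr rfl fun j _ => h.gapsBelow_eq hp j (Finset.mem_range.1 hs),
    Finset.sum_comm, ← Finset.sum_add_distrib]
  refine Finset.sum_congr rfl fun r _ => ?_
  split_ifs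
  · rw [add_zero, sum_range_succ_sub]
  · exact sum_range_sub_add _ _

/-- The abacus with `t` additional beads in front. -/
def shiftBeads (t : ℕ) (B : Finset ℕ) : Finset ℕ :=
  Finset.range t ∪ B.map (addRightEmbedding t)

lemma mem_shiftBeads {t x : ℕ} : x ∈ shiftBeads t B ↔ x < t ∨ ∃ y ∈ B, y + t = x := by
  simp [shiftBeads]

lemma add_mem_shiftBeads {t x : ℕ} : x + t ∈ shiftBeads t B ↔ x ∈ B := by
  simp [mem_shiftBeads]

lemma gapsBelow_shiftBeads (t x : ℕ) : gapsBelow (shiftBeads t B) (x + t) = gapsBelow B x := by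
  have hset : (Finset.range (x + t)).filter (· ∉ shiftBeads t B) =
      ((Finset.range x).filter (· ∉ B)).map (addRightEmbedding t) := by
    ext y
    simp only [Finset.mem_filter, Finset.mem_range, Finset.mem_map, addRightEmbedding_apply]
    constructor
    · rintro ⟨hy, hyB⟩
      have hty : t ≤ y := by
        by_contra hcon
        exact hyB (mem_shiftBeads.2 (Or.inl (not_le.1 hcon)))
      obtain ⟨z, rfl⟩ : ∃ z, y = z + t := ⟨y - t, by omega⟩
      exact ⟨z, ⟨by omega, mt add_mem_shiftBeads.2 hyB⟩, rfl⟩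
    · rintro ⟨z, ⟨hz, hzB⟩, rfl⟩
      exact ⟨by omega, mt add_mem_shiftBeads.1 hzB⟩
  rw [gapsBelow, hset, Finset.card_map, gapsBelow]

lemma sum_gapsBelow_shiftBeads (t : ℕ) :
    ∑ x ∈ shiftBeads t B, gapsBelow (shiftBeads t B) x = ∑ x ∈ B, gapsBelow B x := by
  have hdisj : Disjoint (Finset.range t) (B.map (addRightEmbedding t)) := by
    rw [Finset.disjoint_left]
    intro x hx hx'
    obtain ⟨y, -, rfl⟩ := Finset.mem_map.1 hx'
    rw [Finset.mem_range, addRightEmbedding_apply] at hx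
    omega
  have hzero : ∀ x ∈ Finset.range t, gapsBelow (shiftBeads t B) x = 0 := by
    intro x hx
    rw [Finset.mem_range] at hx
    rw [gapsBelow, Finset.card_eq_zero, Finset.filter_eq_empty_iff]
    intro y hy
    rw [Finset.mem_range] at hy
    rw [not_not, mem_shiftBeads]
    exact Or.inl (hy.trans hx)
  have hsplit : ∀ f : ℕ → ℕ, ∑ x ∈ shiftBeads t B, f x =
      ∑ x ∈ Finset.range t, f x + ∑ x ∈ B, f (x + t) := by
    intro f
    rw [shiftBeads, Finset.sum_union hdisj, Finset.sum_map]
    rfl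
  rw [hsplit, Finset.sum_eq_zero hzero, zero_add]
  exact Finset.sum_congr rfl fun x _ => gapsBelow_shiftBeads t x

/-- A flush abacus with a gap in position `0` can be shifted by fewer than `p` positions such that
the last runner becomes a fullest one: shift the last bead to the last runner. -/
lemma exists_shift (hp : 0 < p) (h0 : 0 ∉ B) (hB : ∀ x, x + p ∈ B → x ∈ B) :
    ∃ t < p, ∃ b, HasRunnerCounts p b (shiftBeads t B) ∧ b t = 0 ∧ ∀ r < p, b r ≤ b (p - 1) := by
  obtain ⟨t, n, htp, hlt, hn⟩ : ∃ t n, t < p ∧ (∀ x ∈ shiftBeads t B, x < n * p) ∧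
      (n = 0 ∨ (n - 1) * p + (p - 1) ∈ shiftBeads t B) := by
    rcases B.eq_empty_or_nonempty with rfl | hne
    · exact ⟨0, 0, hp, by simp [shiftBeads], Or.inl rfl⟩
    · have hmod := Nat.mod_lt (B.max' hne) hp
      have hdiv := Nat.div_add_mod' (B.max' hne) p
      refine ⟨p - 1 - B.max' hne % p, B.max' hne / p + 1, by omega, fun x hx => ?_, Or.inr ?_⟩
      · rw [add_mul, one_mul]
        rcases mem_shiftBeads.1 hx with hx | ⟨y, hy, rfl⟩
        · omega
        · have := B.le_max' y hy
          omega
      · rw [Nat.add_sub_cancel, mem_shiftBeads]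
        exact Or.inr ⟨_, B.max'_mem hne, by omega⟩
  have hflush : ∀ x, x + p ∈ shiftBeads t B → x ∈ shiftBeads t B := by
    intro x hx
    by_cases hxt : x < t
    · exact mem_shiftBeads.2 (Or.inl hxt)
    · obtain ⟨y, rfl⟩ : ∃ y, x = y + t := ⟨x - t, by omega⟩
      rw [add_right_comm, add_mem_shiftBeads] at hx
      exact add_mem_shiftBeads.2 (hB y hx)
  obtain ⟨b, hb⟩ := exists_hasRunnerCounts hp hflush
  refine ⟨t, htp, b, hb, ?_, fun r hr => ?_⟩
  · by_contra hcon
    have h1 := (hb 0 t htp).2 (Nat.pos_of_ne_zero hcon)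
    rw [zero_mul] at h1
    exact h0 (add_mem_shiftBeads.1 h1)
  · have h1 : b r ≤ n := by
      by_contra hcon
      have := hlt _ ((hb n r hr).2 (not_le.1 hcon))
      omega
    rcases hn with rfl | hn
    · omega
    · have := (hb _ _ (show p - 1 < p by omega)).1 hn
      omega

end

/-- The bead counts of the runners in weakly increasing order. -/
lemma exists_sorted (p : ℕ) (b : ℕ → ℕ) : ∃ c : ℕ → ℕ,
    (∀ i, i + 1 < p → c i ≤ c (i + 1)) ∧
    (∀ i < p, ∃ k < p, c i = b k) ∧ (∀ k < p, ∃ i < p, c i = b k) ∧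
    (∀ f : ℕ → ℕ, ∑ i ∈ Finset.range p, f (c i) = ∑ i ∈ Finset.range p, f (b i)) ∧
    ((∀ i k, i ≤ k → k < p → b i ≤ b k) → ∀ i < p, c i = b i) := by
  set β : Fin p → ℕ := fun i => b i with hβ
  set σ := Tuple.sort β with hσ
  have hmono : Monotone (β ∘ σ) := Tuple.monotone_sort β
  set c : ℕ → ℕ := fun i => if h : i < p then β (σ ⟨i, h⟩) else 0 with hc
  have hci : ∀ i (h : i < p), c i = β (σ ⟨i, h⟩) := fun i h => by simp only [hc, dif_pos h]
  refine ⟨c, fun i hi => ?_, fun i hi => ⟨σ ⟨i, hi⟩, Fin.is_lt _, hci i hi⟩,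
    fun k hk => ⟨σ.symm ⟨k, hk⟩, Fin.is_lt _, ?_⟩, fun f => ?_, fun hb i hi => ?_⟩
  · rw [hci i (by omega), hci (i + 1) hi]
    exact hmono (Fin.mk_le_mk.2 (Nat.le_succ i))
  · rw [hci _ (Fin.is_lt _), Fin.eta, Equiv.apply_symm_apply]
  · rw [Finset.sum_range, Finset.sum_range, ← Equiv.sum_comp σ fun i => f (b i)]
    exact Finset.sum_congr rfl fun i _ => by rw [hci _ i.is_lt]
  · have hβm : Monotone β := fun i k hik => hb i k hik k.is_lt
    have h1 : σ = Equiv.refl _ := Tuple.sort_eq_refl_iff_monotone.2 hβm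
    rw [hci i hi, h1]
    rfl

/-! ### Partitions and runner profiles -/

lemma spread_congr {p : ℕ} {b c : ℕ → ℕ}
    (h : ∀ f : ℕ → ℕ, ∑ i ∈ Finset.range p, f (c i) = ∑ i ∈ Finset.range p, f (b i)) :
    spread p c = spread p b := by
  simp only [spread]
  rw [h fun x => ∑ i ∈ Finset.range p, ∑ j ∈ Finset.range (x - c i), (j + 1)]
  exact Finset.sum_congr rfl fun k _ => h fun x => ∑ j ∈ Finset.range (b k - x), (j + 1)

namespace YoungDiagram

/-- Shifting the last bead to the last runner, sorting the runners, and moving all beads to the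
right turns a `p`-core `p'`-partition into a runner profile and does not decrease the size. The
size is kept only if nothing moves. -/
lemma exists_isRunnerProfile {p : ℕ} (hp : p.Prime) {μ : YoungDiagram} (hcore : μ.IsPCore p)
    (hprime : μ.IsPPrime p) : ∃ c, IsRunnerProfile p c ∧ μ.card ≤ spread p c ∧
      (μ.card = spread p c → HasRunnerCounts p c μ.beads) := by
  obtain ⟨t, htp, b, hb, hbt, hmax⟩ :=
    exists_shift hp.pos zero_notMem_beads ((isPCore_iff hp.pos).1 hcore)
  obtain ⟨c, hle, hcb, hbc, hsum, hsorted⟩ := exists_sorted p b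
  have hsize := hb.sum_gapsBelow_add hp.pos
  rw [sum_gapsBelow_shiftBeads, ← card_eq_sum_gapsBelow, ← spread_congr hsum] at hsize
  have hc0 : c 0 = 0 := by
    obtain ⟨i, hi, hci⟩ := hbc t htp
    have := le_of_le_succ hle (Nat.zero_le i) hi
    omega
  refine ⟨c, ⟨hc0, hle, fun j hj => ?_⟩, by omega, fun heq => ?_⟩
  · obtain ⟨k, hk, hck⟩ := hcb (p - 1) (by have := hp.pos; omega)
    have hjb : j < b (p - 1) := by have := hmax k hk; omega
    have hmem := (hb j (p - 1) (by have := hp.pos; omega)).2 hjb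
    rw [hsum fun x => j + 1 - x]
    have hgaps := hb.gapsBelow_eq hp.pos j (show p - 1 < p by have := hp.pos; omega)
    have hsame : ∑ r ∈ Finset.range p, (j + (if r < p - 1 then 1 else 0) - b r) =
        ∑ r ∈ Finset.range p, (j + 1 - b r) := by
      refine Finset.sum_congr rfl fun r hr => ?_
      rw [Finset.mem_range] at hr
      split_ifs with h
      · rfl
      · obtain rfl : r = p - 1 := by omega
        omega
    rw [← hsame, ← hgaps]
    rcases mem_shiftBeads.1 hmem with h | ⟨y, hy, hyx⟩
    · -- the first gap of the shifted abacus is on runner `t`, so a bead in the last runner of row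
      -- `j` is not one of the additional beads
      exact absurd h (by omega)
    · rw [← hyx, gapsBelow_shiftBeads]
      exact isPPrime_iff.1 hprime y hy
  · have hzero : ∑ s ∈ Finset.range p, ∑ r ∈ Finset.range p,
        (if r < s then 0 else b s - b r) = 0 := by omega
    have hmono : ∀ i k, i ≤ k → k < p → b i ≤ b k := by
      intro i k hik hk
      have h1 := Finset.sum_eq_zero_iff.1 hzero i (Finset.mem_range.2 (by omega))
      have h2 := Finset.sum_eq_zero_iff.1 h1 k (Finset.mem_range.2 hk)
      rw [if_neg (by omega)] at h2
      omega
    have hcb' := hsorted hmono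
    -- position `0` of the shifted abacus is a gap, so there are no additional beads
    have ht : t = 0 := by
      by_contra hcon
      have h1 := (hb 0 0 hp.pos).1
        (mem_shiftBeads.2 (Or.inl (by rw [zero_mul]; exact Nat.pos_of_ne_zero hcon)))
      rw [← hcb' 0 hp.pos, hc0] at h1
      exact lt_irrefl _ h1
    intro j r hr
    rw [hcb' r hr, ← hb j r hr, ht]
    exact add_mem_shiftBeads.symm

/-- The partition with a given runner profile. -/
lemma exists_of_isRunnerProfile {p : ℕ} (hp : p.Prime) {c : ℕ → ℕ} (hc : IsRunnerProfile p c) :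
    ∃ μ : YoungDiagram, HasRunnerCounts p c μ.beads ∧ μ.IsPCore p ∧ μ.IsPPrime p ∧
      μ.card = spread p c := by
  set B : Finset ℕ := (Finset.range p).biUnion fun r =>
    (Finset.range (c r)).image fun j => j * p + r with hBdef
  have hB : HasRunnerCounts p c B := by
    intro j r hr
    simp only [hBdef, Finset.mem_biUnion, Finset.mem_image, Finset.mem_range]
    constructor
    · rintro ⟨s, hs, i, hi, h⟩
      have h1 : s = r := by rw [← mul_add_mod_eq hs i, h, mul_add_mod_eq hr]
      subst h1
      rwa [← mul_add_injective hp.pos s h]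
    · intro h
      exact ⟨r, hr, j, h, rfl⟩
  have h0 : 0 ∉ B := by
    intro h
    have := (hB 0 0 hp.pos).1 (by simpa using h)
    rw [hc.zero] at this
    exact lt_irrefl _ this
  obtain ⟨μ, hμ⟩ := exists_beads_eq h0
  rw [← hμ] at hB
  refine ⟨μ, hB, (isPCore_iff hp.pos).2 fun x hx => ?_, isPPrime_iff.2 fun x hx => ?_, ?_⟩
  · have hr := Nat.mod_lt x hp.pos
    rw [← div_mul_add_eq (p := p) (x := x) rfl] at hx ⊢
    rw [add_right_comm, ← Nat.succ_mul, hB _ _ hr] at hx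
    rw [hB _ _ hr]
    exact (Nat.lt_succ_self _).trans hx
  · have hr := Nat.mod_lt x hp.pos
    rw [← div_mul_add_eq (p := p) (x := x) rfl] at hx ⊢
    rw [hB.gapsBelow_eq hp.pos _ hr]
    rw [hB _ _ hr] at hx
    have hlast : c (x % p) ≤ c (p - 1) := le_of_le_succ hc.le_succ (by omega) (by omega)
    have hnd := hc.not_dvd _ (hx.trans_le hlast)
    have hsame : ∑ i ∈ Finset.range p, (x / p + (if i < x % p then 1 else 0) - c i) =
        ∑ i ∈ Finset.range p, (x / p + 1 - c i) := by
      refine Finset.sum_congr rfl fun i hi => ?_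
      rw [Finset.mem_range] at hi
      split_ifs with h
      · rfl
      · have := le_of_le_succ hc.le_succ (not_lt.1 h) hi
        omega
    rwa [hsame]
  · rw [card_eq_sum_gapsBelow, ← hB.sum_gapsBelow_add hp.pos, eq_comm, Nat.add_eq_left]
    refine Finset.sum_eq_zero fun s hs => Finset.sum_eq_zero fun r hr => ?_
    rw [Finset.mem_range] at hr
    split_ifs with h
    · rfl
    · have := le_of_le_succ hc.le_succ (not_lt.1 h) hr
      omega

lemma beadsRightmost_of_hasRunnerCounts {p : ℕ} {c : ℕ → ℕ} {μ : YoungDiagram}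
    (hle : ∀ i, i + 1 < p → c i ≤ c (i + 1)) (h : HasRunnerCounts p c μ.beads) :
    μ.BeadsRightmost p := by
  intro j x hx y hy hxy hxb
  obtain ⟨r, rfl⟩ : ∃ r, x = j * p + r := ⟨x - j * p, by
    have := (Finset.mem_Ico.1 hx).1; omega⟩
  obtain ⟨s, rfl⟩ : ∃ s, y = j * p + s := ⟨y - j * p, by
    have := (Finset.mem_Ico.1 hy).1; omega⟩
  have hr : r < p := by have := (Finset.mem_Ico.1 hx).2; omega
  have hs : s < p := by have := (Finset.mem_Ico.1 hy).2; omega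
  rw [h _ _ hr] at hxb
  exact (h _ _ hs).2 (hxb.trans_le (le_of_le_succ hle (by omega) hs))

lemma rowGaps_add_rowBeads (p : ℕ) (μ : YoungDiagram) (j : ℕ) :
    μ.rowGaps p j + μ.rowBeads p j = p := by
  have h := Finset.card_filter_add_card_filter_not (s := abacusRow p j) (· ∈ μ.beads)
  rw [abacusRow, Nat.card_Ico, Nat.add_sub_cancel_left] at h
  rw [rowGaps, rowBeads, add_comm]
  exact h

lemma rowGaps_eq_card {p : ℕ} {c : ℕ → ℕ} {μ : YoungDiagram}
    (h : HasRunnerCounts p c μ.beads) (j : ℕ) :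
    μ.rowGaps p j = ((Finset.range p).filter fun r => c r ≤ j).card := by
  have hset : (abacusRow p j).filter (· ∉ μ.beads) =
      ((Finset.range p).filter fun r => c r ≤ j).image fun r => j * p + r := by
    ext x
    simp only [abacusRow, Finset.mem_filter, Finset.mem_Ico, Finset.mem_image, Finset.mem_range]
    constructor
    · rintro ⟨⟨h1, h2⟩, h3⟩
      obtain ⟨r, rfl⟩ : ∃ r, x = j * p + r := ⟨x - j * p, by omega⟩
      have hr : r < p := by omega
      rw [h _ _ hr, not_lt] at h3
      exact ⟨r, ⟨hr, h3⟩, rfl⟩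
    · rintro ⟨r, ⟨hr, h3⟩, rfl⟩
      exact ⟨⟨by omega, by omega⟩, by rw [h _ _ hr]; omega⟩
  rw [rowGaps, hset, Finset.card_image_of_injective _ (add_right_injective (j * p))]

/-- If the bead counts of the runners increase, the rows with `i` gaps are those from `c (i - 1)`
to `c i - 1`. -/
lemma rowMultiplicity_eq {p : ℕ} {c : ℕ → ℕ} {μ : YoungDiagram}
    (hle : ∀ i, i + 1 < p → c i ≤ c (i + 1)) (h : HasRunnerCounts p c μ.beads) {i : ℕ}
    (hi : 0 < i) (hip : i < p) : μ.rowMultiplicity p i = c i - c (i - 1) := by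
  have hset : {j : ℕ | μ.rowGaps p j = i ∧ μ.rowBeads p j = p - i} =
      (Finset.Ico (c (i - 1)) (c i) : Set ℕ) := by
    ext j
    have hadd := rowGaps_add_rowBeads p μ j
    have hcard := rowGaps_eq_card h j
    simp only [Set.mem_ofPred_eq, Finset.coe_Ico, Set.mem_Ico]
    constructor
    · rintro ⟨hg, -⟩
      rw [hg] at hcard
      constructor
      · by_contra hcon
        have hsub : ((Finset.range p).filter fun r => c r ≤ j) ⊆ Finset.range (i - 1) := by
          intro r hr
          simp only [Finset.mem_filter, Finset.mem_range] at hr ⊢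
          by_contra hri
          have := le_of_le_succ hle (not_lt.1 hri) hr.1
          omega
        have := Finset.card_le_card hsub
        rw [Finset.card_range] at this
        omega
      · by_contra hcon
        have hsub : Finset.range (i + 1) ⊆ (Finset.range p).filter fun r => c r ≤ j := by
          intro r hr
          simp only [Finset.mem_filter, Finset.mem_range] at hr ⊢
          have := le_of_le_succ hle (show r ≤ i by omega) hip
          exact ⟨by omega, by omega⟩
        have := Finset.card_le_card hsub
        rw [Finset.card_range] at this
        omega
    · rintro ⟨h1, h2⟩
      have hfil : ((Finset.range p).filter fun r => c r ≤ j) = Finset.range i := by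
        ext r
        simp only [Finset.mem_filter, Finset.mem_range]
        constructor
        · rintro ⟨hr, hrj⟩
          by_contra hri
          have := le_of_le_succ hle (not_lt.1 hri) hr
          omega
        · intro hr
          have := le_of_le_succ hle (show r ≤ i - 1 by omega) (by omega)
          exact ⟨by omega, by omega⟩
      rw [hfil, Finset.card_range] at hcard
      omega
  rw [rowMultiplicity, hset, Set.ncard_coe_finset, Nat.card_Ico]

end YoungDiagram

theorem mainTheorem5 (p : ℕ) (hp : p.Prime) (hodd : Odd p) :
    ∃ μ : YoungDiagram,
      μ.IsLargestPCorePPrime p ∧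
      (∀ ν : YoungDiagram, ν.IsLargestPCorePPrime p → ν = μ) ∧
      μ.BeadsRightmost p ∧
      (∀ i : ℕ, 2 ≤ i → i ≤ p - 2 →
        μ.rowMultiplicity p i = μ.rowMultiplicity p (p - i)) ∧
      μ.rowMultiplicity p 1 = μ.rowMultiplicity p (p - 1) + 1 := by
  have hp2 := hp.two_le
  obtain ⟨d, hd, hopt, hsymm, hone⟩ := exists_optimal_runnerProfile hp hodd
  obtain ⟨μ, hμ, hcore, hprime, hcard⟩ := YoungDiagram.exists_of_isRunnerProfile hp hd
  refine ⟨μ, ⟨hcore, hprime, fun ν hνc hνp => ?_⟩, fun ν hν => ?_,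
    YoungDiagram.beadsRightmost_of_hasRunnerCounts hd.le_succ hμ, fun i hi hip => ?_, ?_⟩
  · obtain ⟨c, hc, hle, -⟩ := YoungDiagram.exists_isRunnerProfile hp hνc hνp
    exact hcard ▸ hle.trans (hopt c hc).1
  · obtain ⟨c, hc, hle, heq⟩ := YoungDiagram.exists_isRunnerProfile hp hν.1 hν.2.1
    have h1 := hν.2.2 μ hcore hprime
    have h2 := (hopt c hc).1
    have hcd := (hopt c hc).2 (by omega)
    have hνb := heq (by omega)
    apply YoungDiagram.beads_injective
    ext x
    have hr := Nat.mod_lt x hp.pos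
    rw [← div_mul_add_eq (p := p) (x := x) rfl, hνb _ _ hr, hμ _ _ hr, hcd _ hr]
  · rw [YoungDiagram.rowMultiplicity_eq hd.le_succ hμ (by omega) (by omega),
      YoungDiagram.rowMultiplicity_eq hd.le_succ hμ (by omega) (by omega)]
    exact hsymm i hi hip
  · rw [YoungDiagram.rowMultiplicity_eq hd.le_succ hμ (by omega) (by omega),
      YoungDiagram.rowMultiplicity_eq hd.le_succ hμ (by omega) (by omega)]
    exact hone
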